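/- Let $\mathbb{H}=\{z\in\mathbb{C}:\operatorname{Im} z>0\}$, let $\widehat{\mathbb{R}}=\mathbb{R}\cup\{\infty\}$ be regarded as a subset of the Riemann sphere $\widehat{\mathbb{C}}=\mathbb{C}\cup\{\infty\}$, and let $\mathcal{P}$ be the Pick class, that is, the set of analytic functions $f$ on $\mathbb{H}$ with $\operatorname{Im} f(z)\ge 0$ for all $z\in\mathbb{H}$. Let $m\ge 0$ be an integer and $n=2m$. Suppose that $f\in\mathcal{P}$ has unrestricted pseudo-Taylor coefficients $a_0,\dots,a_n\in\mathbb{C}$ at $0$, that is, \[ \lim_{z\to 0,\ z\in\mathbb{H}} \frac{f^{(k)}(z)}{k!}=a_k\qquad (k=0,1,\dots,n), \] where $z$ tends to $0$ in $\mathbb{H}$ without further restriction, and suppose that $a_0,\dots,a_{n-1}\in\mathbb{R}$ and $a_n\in\mathbb{H}$. Then there is a rational function $f_0$ of degree $m+1$ (the degree being the maximum of the degrees of numerator and denominator in lowest terms) such that 1. the restriction of $f_0$ to $\mathbb{H}$ belongs to $\mathcal{P}$, and $f_0$ is analytic at $0$; 2. the initial Taylor coefficients of $f_0$ at $0$ are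 $a_0,\dots,a_n$, i.e. $f_0^{(k)}(0)/k!=a_k$ for $k=0,\dots,n$; 3. $f_0$ maps $\widehat{\mathbb{R}}\setminus\{0\}$ into $\mathbb{H}$ (in particular $f_0(\infty)\in\mathbb{H}$); 4. $0$ is a regular value of $f_0$, i.e. $f_0^{-1}(\{0\})\subset\widehat{\mathbb{C}}$ consists of exactly $m+1$ distinct points. -/

import Mathlib

open Filter Topology

noncomputable section

namespace PickInterp

/-- The open upper half-plane, as a subset of the complex plane. -/
def UHP : Set ℂ := {z | 0 < z.im}

/-- The Pick class: functions analytic on the upper half-plane with nonnegative imaginary part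
there. The values of `f` off the upper half-plane play no role. -/
def Pick : Set (ℂ → ℂ) := {f | AnalyticOnNhd ℂ f UHP ∧ ∀ z ∈ UHP, 0 ≤ (f z).im}

/-- Pick functions that are analytic at the real point `x`; here `f` also stands for its analytic
extension to a neighbourhood of `x`. -/
def PickAt (x : ℝ) : Set (ℂ → ℂ) := {f | f ∈ Pick ∧ AnalyticAt ℂ f (x : ℂ)}

/-- `f` has unrestricted pseudo-Taylor coefficients `a 0, …, a n` at `0`: for every `k ≤ n`,
`f⁽ᵏ⁾(z) / k!` tends to `a k` as `z` tends to `0` without restriction in the upper half-plane. -/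
def HasPseudoTaylorCoeffs (f : ℂ → ℂ) (n : ℕ) (a : ℕ → ℂ) : Prop :=
  ∀ k ≤ n, Tendsto (fun z => iteratedDeriv k f z / (k.factorial : ℂ)) (𝓝[UHP] 0) (𝓝 (a k))

/-- `f` is analytic at `0` with initial Taylor coefficients `a 0, …, a n` there. -/
def HasTaylorCoeffs (f : ℂ → ℂ) (n : ℕ) (a : ℕ → ℂ) : Prop :=
  AnalyticAt ℂ f 0 ∧ ∀ k ≤ n, iteratedDeriv k f 0 / (k.factorial : ℂ) = a k

/-- The function on the plane given by a rational function (with value `0` at the poles). -/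
def toFun (R : RatFunc ℂ) (z : ℂ) : ℂ := RatFunc.eval (RingHom.id ℂ) z R

/-- The degree of a rational function: the larger of the degrees of numerator and denominator
in lowest terms. -/
def degree (R : RatFunc ℂ) : ℕ := max R.num.natDegree R.denom.natDegree

/-- The self-map of the Riemann sphere given by a rational function. -/
def sphereMap (R : RatFunc ℂ) : OnePoint ℂ → OnePoint ℂ
  | some z =>
      if R.denom.eval z = 0 then OnePoint.infty
      else ((R.num.eval z / R.denom.eval z : ℂ) : OnePoint ℂ)
  | none =>
      if R.denom.natDegree < R.num.natDegree then OnePoint.infty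
      else ((R.num.coeff R.denom.natDegree / R.denom.leadingCoeff : ℂ) : OnePoint ℂ)

/-- The extended real line, as a subset of the Riemann sphere. -/
def extendedReals : Set (OnePoint ℂ) :=
  insert OnePoint.infty (Set.range fun x : ℝ => ((x : ℂ) : OnePoint ℂ))

/-- `c` is a regular value of `R`: its preimage in the Riemann sphere consists of exactly
`degree R` distinct points. -/
def IsRegularValue (R : RatFunc ℂ) (c : OnePoint ℂ) : Prop :=
  (sphereMap R ⁻¹' {c}).encard = (degree R : ℕ∞)

end PickInterp

end

/-!
A solution is built by running the boundary Schur–Nevanlinna algorithm down to degree zero and back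
up, starting the way up from a one-parameter family.

The pseudo-Taylor coefficients give an expansion `f = p + α z²ᵐ + o(z²ᵐ)` in the upper half-plane,
with `p` a real polynomial and `Im α > 0` (`HasPseudoTaylorCoeffs.isLittleO`). If `m > 0`, comparing
`Im f ≥ 0` with the leading term of `f - a₀` along rays shows `a₁ > 0` (`coeff_one_pos`). The Julia
reduction `g = 1 / (a₁ z) - 1 / (f - a₀)` is again in the Pick class: `Im g ≥ Im (1 / (a₁ z))`, which
is small near the real line away from `0` and near `∞`, while the expansion gives `g` a limit
with nonnegative imaginary part at `0`, so the maximum principle applies (`julia_mem_Pick`).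
Moreover `g` has an expansion of the same kind with `m - 1` in place of `m`
(`exists_julia_reduction`).

Conversely `f = a₀ + a₁ z / (1 - a₁ z g)` turns a rational interpolant for `g` into one for `f`,
raises its degree by one, and preserves strict positivity of the imaginary part on the closed upper
half-plane without `0` (`IsInterpolant.julia`). Being linear in numerator and denominator, it
preserves pencils `(N₀ + τ N₁) / (D₀ + τ D₁)`. For `m = 0` the pencil `a + i z / (z + i τ)`, `τ > 0`,
is available, and `N₀ D₁ - N₁ D₀ = -z` there, hence a nonzero multiple of `z²ᵐ⁺¹` in general
(`IsPencil.julia`). This determinant gives coprimality (`IsPencil.isCoprime`). It also shows that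
outside `0` the polynomials `N₀` and `N₁` have no common zero, so a multiple zero of `N₀ + τ N₁`
is a zero of their nonzero Wronskian and determines `τ`; all but finitely many `τ` make `0` a
regular value (`IsPencil.exists_simple_zeros`).
-/

namespace PickInterp

open Polynomial Asymptotics ComplexConjugate

/-! ### Asymptotic expansions in the upper half-plane -/

lemma isOpen_UHP : IsOpen UHP := isOpen_lt continuous_const Complex.continuous_im

lemma convex_UHP : Convex ℝ UHP := convex_halfSpace_im_gt 0

lemma ne_zero_of_mem_UHP {z : ℂ} (hz : z ∈ UHP) : z ≠ 0 := by
  rintro rfl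
  simp [UHP] at hz

/-- Rays in the upper half-plane approach the origin within it. -/
lemma tendsto_ray {ζ : ℂ} (hζ : ζ ∈ UHP) :
    Tendsto (fun r : ℝ => (r : ℂ) * ζ) (𝓝[>] 0) (𝓝[UHP] 0) := by
  refine tendsto_nhdsWithin_iff.2 ⟨?_, ?_⟩
  · have : Continuous fun r : ℝ => (r : ℂ) * ζ := by fun_prop
    simpa using (this.tendsto 0).mono_left nhdsWithin_le_nhds
  · filter_upwards [self_mem_nhdsWithin] with r hr
    have : 0 < r * ζ.im := mul_pos hr hζ
    simpa [UHP] using this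

instance neBot_nhdsWithin_UHP : (𝓝[UHP] (0 : ℂ)).NeBot :=
  (tendsto_ray (ζ := Complex.I) (by simp [UHP])).neBot

/-- Integration of a little-o estimate along segments in the upper half-plane. -/
lemma isLittleO_pow_succ_of_deriv {h : ℂ → ℂ} {k : ℕ} (hd : DifferentiableOn ℂ h UHP)
    (h0 : Tendsto h (𝓝[UHP] 0) (𝓝 0)) (hk : deriv h =o[𝓝[UHP] 0] fun z => z ^ k) :
    h =o[𝓝[UHP] 0] fun z => z ^ (k + 1) := by
  rw [isLittleO_iff] at hk ⊢
  intro c hc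
  have hk := hk hc
  rw [eventually_nhdsWithin_iff, Metric.eventually_nhds_iff] at hk ⊢
  obtain ⟨δ, hδ, hb⟩ := hk
  refine ⟨δ, hδ, fun z hz hzU => ?_⟩
  have hcv : Convex ℝ (UHP ∩ Metric.closedBall 0 ‖z‖) :=
    convex_UHP.inter (convex_closedBall _ _)
  have key : ∀ w ∈ UHP ∩ Metric.closedBall 0 ‖z‖, ‖h z - h w‖ ≤ c * ‖z‖ ^ k * ‖z - w‖ := by
    intro w hw
    refine hcv.norm_image_sub_le_of_norm_deriv_le
      (fun x hx => (hd x hx.1).differentiableAt (isOpen_UHP.mem_nhds hx.1)) (fun x hx => ?_) hw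
      ⟨hzU, by simp⟩
    have hxz : ‖x‖ ≤ ‖z‖ := by simpa using hx.2
    have h1 := hb (y := x) (lt_of_le_of_lt (by simpa using hxz) hz) hx.1
    rw [norm_pow] at h1
    exact h1.trans (by gcongr)
  have hlim : Tendsto (fun w => ‖h z - h w‖) (𝓝[UHP] 0) (𝓝 ‖h z - 0‖) :=
    (tendsto_const_nhds.sub h0).norm
  have hlim2 : Tendsto (fun w : ℂ => c * ‖z‖ ^ k * ‖z - w‖) (𝓝[UHP] 0)
      (𝓝 (c * ‖z‖ ^ k * ‖z - 0‖)) := by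
    have : Continuous fun w : ℂ => c * ‖z‖ ^ k * ‖z - w‖ := by fun_prop
    exact (this.tendsto 0).mono_left nhdsWithin_le_nhds
  have hev : ∀ᶠ w in 𝓝[UHP] (0 : ℂ), ‖h z - h w‖ ≤ c * ‖z‖ ^ k * ‖z - w‖ := by
    filter_upwards [self_mem_nhdsWithin, nhdsWithin_le_nhds
      (Metric.closedBall_mem_nhds (0 : ℂ) (norm_pos_iff.2 (ne_zero_of_mem_UHP hzU)))] with w h1 h2
    exact key w ⟨h1, h2⟩
  have := le_of_tendsto_of_tendsto hlim hlim2 hev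
  simpa [pow_succ, mul_assoc] using this

/-- Pseudo-Taylor coefficients give an asymptotic expansion in the upper half-plane. -/
lemma HasPseudoTaylorCoeffs.isLittleO {f : ℂ → ℂ} {n : ℕ} {a : ℕ → ℂ} (P : ℂ[X])
    (hf : f ∈ Pick) (hfa : HasPseudoTaylorCoeffs f n a) (hP : ∀ k ≤ n, P.coeff k = a k) :
    (fun z => f z - P.eval z) =o[𝓝[UHP] 0] fun z => z ^ n := by
  have han : ∀ k, AnalyticOnNhd ℂ (iteratedDeriv k f) UHP := fun k => by
    rw [iteratedDeriv_eq_iterate]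
    exact hf.1.iterated_deriv k
  have h0 : ∀ k ≤ n, Tendsto (fun z => iteratedDeriv k f z - (derivative^[k] P).eval z)
      (𝓝[UHP] 0) (𝓝 0) := by
    intro k hk
    have h1 := (hfa k hk).mul_const (k.factorial : ℂ)
    have hfac : (k.factorial : ℂ) ≠ 0 := Nat.cast_ne_zero.2 k.factorial_ne_zero
    simp only [div_mul_cancel₀ _ hfac] at h1
    have h2 : Tendsto (fun z => (derivative^[k] P).eval z) (𝓝[UHP] 0)
        (𝓝 ((derivative^[k] P).eval 0)) :=
      ((derivative^[k] P).continuous.tendsto 0).mono_left nhdsWithin_le_nhds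
    have h3 : (derivative^[k] P).eval 0 = a k * k.factorial := by
      rw [← coeff_zero_eq_eval_zero, coeff_iterate_derivative, zero_add,
        Nat.descFactorial_self, nsmul_eq_mul, hP k hk, mul_comm]
    rw [h3] at h2
    simpa using h1.sub h2
  have hstep : ∀ j ≤ n, (fun z => iteratedDeriv (n - j) f z - (derivative^[n - j] P).eval z)
      =o[𝓝[UHP] 0] fun z => z ^ j := by
    intro j
    induction j with
    | zero =>
      intro _
      simpa using (isLittleO_one_iff ℂ).2 (h0 n le_rfl)
    | succ j ih =>
      intro hj
      have hd : ∀ z ∈ UHP, HasDerivAt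
          (fun z => iteratedDeriv (n - (j + 1)) f z - (derivative^[n - (j + 1)] P).eval z)
          (iteratedDeriv (n - j) f z - (derivative^[n - j] P).eval z) z := by
        intro z hz
        have hn : n - j = n - (j + 1) + 1 := by omega
        rw [hn, iteratedDeriv_succ, Function.iterate_succ_apply']
        exact ((han _ z hz).differentiableAt.hasDerivAt).sub (Polynomial.hasDerivAt _ z)
      refine isLittleO_pow_succ_of_deriv
        (fun z hz => (hd z hz).differentiableAt.differentiableWithinAt) (h0 _ (by omega)) ?_
      refine (ih (by omega)).congr' ?_ EventuallyEq.rfl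
      filter_upwards [self_mem_nhdsWithin] with z hz using (hd z hz).deriv.symm
  simpa using hstep n le_rfl

/-! ### Jets with real coefficients -/

/-- The polynomial `p + α Xⁿ`, for a real polynomial `p` and a complex number `α`. Asymptotic data
are recorded in this form, so that `p` only matters modulo `Xⁿ` and, up to a real shift, in
degree `n`. -/
noncomputable def jet (p : ℝ[X]) (α : ℂ) (n : ℕ) : ℂ[X] :=
  p.map (algebraMap ℝ ℂ) + C α * X ^ n

lemma jet_succ (p : ℝ[X]) (α : ℂ) (n : ℕ) :
    jet p α (n + 1) = C (p.coeff 0 : ℂ) + X * jet p.divX α n := by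
  have h := congrArg (Polynomial.map (algebraMap ℝ ℂ)) (divX_mul_X_add p)
  simp only [Polynomial.map_add, Polynomial.map_mul, map_X, map_C, Complex.coe_algebraMap] at h
  rw [jet, jet, ← h]
  ring

lemma jet_eval_zero_succ (p : ℝ[X]) (α : ℂ) (n : ℕ) :
    (jet p α (n + 1)).eval 0 = (p.coeff 0 : ℂ) := by
  rw [jet_succ]; simp

lemma jet_eval_zero_zero (p : ℝ[X]) (α : ℂ) :
    (jet p α 0).eval 0 = (p.coeff 0 : ℂ) + α := by
  have h : (p.map (algebraMap ℝ ℂ)).eval 0 = (p.coeff 0 : ℂ) := by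
    rw [← coeff_zero_eq_eval_zero, coeff_map]; rfl
  rw [jet, eval_add, h]
  simp

/-- The jet of the Julia reduction: `1 - a₁ X G` inverts `(p + α X²ᵐ⁺² - a₀) / (a₁ X)` up to order
`2m + 2`. The real part of the inverse comes from an inverse of `(p - a₀) / X` modulo `X²ᵐ⁺²`, and
the first nonreal coefficient of `G` is `α / a₁²`. -/
lemma exists_reduced_jet (p : ℝ[X]) (α : ℂ) (m : ℕ) (h : p.coeff 1 ≠ 0) :
    ∃ (q : ℝ[X]) (K : ℂ[X]),
      jet p.divX α (2 * m + 1) *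
          (1 - C (p.coeff 1 : ℂ) * X * jet q (α / (p.coeff 1 : ℂ) ^ 2) (2 * m)) =
        C (p.coeff 1 : ℂ) + X ^ (2 * m + 2) * K := by
  have hp0 : p.divX.coeff 0 = p.coeff 1 := by simp [coeff_divX]
  have hcop : IsCoprime p.divX (X ^ (2 * m + 2)) := by
    refine IsCoprime.pow_right ?_
    refine ⟨C (p.coeff 1)⁻¹, -C (p.coeff 1)⁻¹ * p.divX.divX, ?_⟩
    nth_rewrite 1 [← divX_mul_X_add p.divX]
    rw [hp0]
    have : C (p.coeff 1)⁻¹ * C (p.coeff 1) = (1 : ℝ[X]) := by rw [← C_mul, inv_mul_cancel₀ h, C_1]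
    linear_combination this
  obtain ⟨s, t, hst⟩ := hcop
  have hs0 : s.coeff 0 * p.coeff 1 = 1 := by
    have := congrArg (fun P : ℝ[X] => P.coeff 0) hst
    simpa [coeff_X_pow, mul_coeff_zero, hp0] using this
  generalize hb : p.coeff 1 = b at *
  have e1 := congrArg (Polynomial.map (algebraMap ℝ ℂ)) (divX_mul_X_add p.divX)
  have e2 := congrArg (Polynomial.map (algebraMap ℝ ℂ)) (divX_mul_X_add s)
  have e3 := congrArg (Polynomial.map (algebraMap ℝ ℂ)) hst
  have e4 : C (s.coeff 0 : ℂ) * C (b : ℂ) = 1 := by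
    rw [← C_mul, ← Complex.ofReal_mul, hs0]; simp
  simp only [Polynomial.map_add, Polynomial.map_mul, map_X, map_C, Complex.coe_algebraMap,
    Polynomial.map_pow, Polynomial.map_one, hp0] at e1 e2 e3
  have hbC : (b : ℂ) ≠ 0 := Complex.ofReal_ne_zero.2 h
  set β : ℂ := α / (b : ℂ) ^ 2 with hβ
  have e5 : C β * C (b : ℂ) ^ 2 = C α := by
    rw [← C_pow, ← C_mul, hβ, div_mul_cancel₀ _ (pow_ne_zero 2 hbC)]
  refine ⟨-s.divX, -C (b : ℂ) * t.map (algebraMap ℝ ℂ)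
    - C (b : ℂ) * C β * p.divX.divX.map (algebraMap ℝ ℂ)
    + C (b : ℂ) * C α * s.divX.map (algebraMap ℝ ℂ)
    - C (b : ℂ) * C α * C β * X ^ (2 * m), ?_⟩
  simp only [jet, Polynomial.map_neg]
  generalize p.divX.map (algebraMap ℝ ℂ) = P1 at *
  generalize p.divX.divX.map (algebraMap ℝ ℂ) = P2 at *
  generalize s.map (algebraMap ℝ ℂ) = S at *
  generalize s.divX.map (algebraMap ℝ ℂ) = S1 at *
  generalize t.map (algebraMap ℝ ℂ) = T at *
  generalize C (s.coeff 0 : ℂ) = s0 at *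
  generalize C (b : ℂ) = B at *
  generalize C β = Β at *
  generalize C α = A at *
  have hx : (1 - B * X * (-S1 + Β * X ^ (2 * m))) = B * S - B * Β * X ^ (2 * m + 1) := by
    rw [← e2]; linear_combination -e4
  rw [hx]
  have hx2 : (P1 + A * X ^ (2 * m + 1)) * (B * S - B * Β * X ^ (2 * m + 1)) =
      B * (S * P1) - B * Β * X ^ (2 * m + 1) * P1 + B * A * X ^ (2 * m + 1) * S
        - B * A * Β * X ^ (2 * m + 1) * X ^ (2 * m + 1) := by ring
  have hx3 : S * P1 = 1 - T * X ^ (2 * m + 2) := by linear_combination e3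
  rw [hx2, hx3, ← e1, ← e2]
  linear_combination (A * X ^ (2 * m + 1)) * e4 - X ^ (2 * m + 1) * e5

/-- Nonnegativity of the imaginary part passes to the leading term of an asymptotic expansion, along
each ray. -/
lemma im_nonneg_of_isLittleO {f : ℂ → ℂ} {c : ℂ} {k : ℕ} (hf : ∀ z ∈ UHP, 0 ≤ (f z).im)
    (h : (fun z => f z - c * z ^ k) =o[𝓝[UHP] 0] fun z => z ^ k) {ζ : ℂ} (hζ : ζ ∈ UHP) :
    0 ≤ (c * ζ ^ k).im := by
  have h1 := (h.comp_tendsto (tendsto_ray hζ)).tendsto_div_nhds_zero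
  have h2 : Tendsto (fun r : ℝ => ((r : ℂ) ^ k)⁻¹ * f (r * ζ)) (𝓝[>] 0) (𝓝 (c * ζ ^ k)) := by
    have h3 := (h1.mul_const (ζ ^ k)).add_const (c * ζ ^ k)
    rw [zero_mul, zero_add] at h3
    refine h3.congr' ?_
    filter_upwards [self_mem_nhdsWithin] with r hr
    have hr0 : (r : ℂ) ≠ 0 := Complex.ofReal_ne_zero.2 (ne_of_gt hr)
    have hz0 := ne_zero_of_mem_UHP hζ
    simp only [Function.comp]
    field_simp
    ring
  refine ge_of_tendsto ((Complex.continuous_im.tendsto _).comp h2) ?_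
  filter_upwards [self_mem_nhdsWithin] with r hr
  have hr' : (0 : ℝ) < r := hr
  have : (r : ℂ) * ζ ∈ UHP := by
    have : 0 < r * ζ.im := mul_pos hr' hζ
    simpa [UHP] using this
  have h4 : ((r : ℂ) ^ k)⁻¹ = ((r ^ k)⁻¹ : ℝ) := by push_cast; rfl
  simp only [Function.comp]
  rw [h4, Complex.im_ofReal_mul]
  exact mul_nonneg (by positivity) (hf _ this)

/-- For `k ≥ 2` the directions of the upper half-plane, raised to the power `k`, wind through four
points spaced by quarter turns. -/
lemma eq_zero_of_im_mul_pow_nonneg {c : ℂ} {k : ℕ} (hk : 2 ≤ k)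
    (h : ∀ ζ ∈ UHP, 0 ≤ (c * ζ ^ k).im) : c = 0 := by
  -- The arguments `j π / (4 k)`, `j = 1, 3, 5, 7`, lie in `(0, π)` since `7 < 4 k`.
  have hk0 : (0 : ℝ) < k := by positivity
  have key : ∀ j : ℕ, 1 ≤ j → j ≤ 7 →
      0 ≤ (c * Complex.exp (((j : ℝ) * Real.pi / 4 : ℝ) * Complex.I)).im := by
    intro j h1 h7
    have hj1 : (1 : ℝ) ≤ j := by exact_mod_cast h1
    have hj7 : (j : ℝ) ≤ 7 := by exact_mod_cast h7
    have hk2 : (2 : ℝ) ≤ k := by exact_mod_cast hk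
    have := h (Complex.exp (((j : ℝ) * Real.pi / (4 * k) : ℝ) * Complex.I)) (by
      change 0 < (Complex.exp _).im
      rw [Complex.exp_ofReal_mul_I_im]
      apply Real.sin_pos_of_pos_of_lt_pi
      · positivity
      · rw [div_lt_iff₀ (by positivity)]
        nlinarith [Real.pi_pos])
    rw [← Complex.exp_nat_mul] at this
    convert this using 4
    push_cast
    have : (k : ℂ) ≠ 0 := by exact_mod_cast hk0.ne'
    field_simp
  have e : ∀ j : ℕ, Complex.exp ((((j + 2 : ℕ) : ℝ) * Real.pi / 4 : ℝ) * Complex.I) =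
      Complex.exp (((j : ℝ) * Real.pi / 4 : ℝ) * Complex.I) * Complex.I := by
    intro j
    have hI : Complex.exp (((j : ℝ) * Real.pi / 4 : ℝ) * Complex.I) * Complex.I =
        Complex.exp (((j : ℝ) * Real.pi / 4 : ℝ) * Complex.I) *
          Complex.exp (Real.pi / 2 * Complex.I) := by
      rw [Complex.exp_pi_div_two_mul_I]
    rw [hI, ← Complex.exp_add]
    congr 1
    push_cast
    ring
  have k1 := key 1 (by norm_num) (by norm_num)
  have k3 := key 3 (by norm_num) (by norm_num)
  have k5 := key 5 (by norm_num) (by norm_num)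
  have k7 := key 7 (by norm_num) (by norm_num)
  rw [e 5, e 3, e 1] at k7
  rw [e 3, e 1] at k5
  rw [e 1] at k3
  set E := Complex.exp ((((1 : ℕ) : ℝ) * Real.pi / 4 : ℝ) * Complex.I) with hE
  have h3 : (c * (E * Complex.I)).im = (c * E).re := by rw [← mul_assoc]; simp
  have h5 : (c * (E * Complex.I * Complex.I)).im = -(c * E).im := by
    simp [mul_assoc]
  have h7 : (c * (E * Complex.I * Complex.I * Complex.I)).im = -(c * E).re := by
    rw [show c * (E * Complex.I * Complex.I * Complex.I) =
      (c * E) * (Complex.I * Complex.I) * Complex.I by ring, Complex.I_mul_I]; simp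
  rw [h3] at k3; rw [h5] at k5; rw [h7] at k7
  have : c * E = 0 := Complex.ext (by rw [Complex.zero_re]; linarith) (by rw [Complex.zero_im]; linarith)
  exact (mul_eq_zero.1 this).resolve_right (Complex.exp_ne_zero _)

/-! ### The Julia reduction of a Pick function -/

lemma isBigO_pow_of_le {i j : ℕ} (h : i ≤ j) :
    (fun z : ℂ => z ^ j) =O[𝓝[UHP] 0] fun z => z ^ i := by
  obtain ⟨d, rfl⟩ := Nat.exists_eq_add_of_le h
  simp only [pow_add]
  have hc : Tendsto (fun z : ℂ => z ^ d) (𝓝[UHP] 0) (𝓝 (0 ^ d)) :=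
    ((continuous_pow d).tendsto 0).mono_left nhdsWithin_le_nhds
  simpa using (isBigO_refl (fun z : ℂ => z ^ i) (𝓝[UHP] 0)).mul (hc.isBigO_one ℂ)

lemma tendsto_eval (P : ℂ[X]) : Tendsto (fun z => P.eval z) (𝓝[UHP] 0) (𝓝 (P.eval 0)) :=
  (P.continuous.tendsto 0).mono_left nhdsWithin_le_nhds

/-- The leading coefficient `a₁` of an expansion with a nonreal coefficient in positive even degree
is positive. -/
lemma coeff_one_pos {f : ℂ → ℂ} {p : ℝ[X]} {α : ℂ} {m : ℕ} (hf : f ∈ Pick) (hα : 0 < α.im)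
    (h : (fun z => f z - (jet p α (2 * m + 2)).eval z) =o[𝓝[UHP] 0] fun z => z ^ (2 * m + 2)) :
    0 < p.coeff 1 := by
  set J := jet p.divX α (2 * m + 1) with hJ
  have hJc : J.coeff (2 * m + 1) ≠ 0 := by
    intro h0
    have := congrArg Complex.im h0
    simp [hJ, jet, coeff_map] at this
    exact hα.ne' this
  have hJ0 : J ≠ 0 := by rintro h0; exact hJc (by rw [h0]; simp)
  obtain ⟨J', hJ', hnd⟩ := exists_eq_pow_rootMultiplicity_mul_and_not_dvd J hJ0 0
  generalize rootMultiplicity 0 J = j at hJ'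
  rw [C_0, sub_zero] at hJ' hnd
  have hj : j ≤ 2 * m + 1 := by
    by_contra! hlt
    exact hJc (X_pow_dvd_iff.1 ⟨J', hJ'⟩ _ hlt)
  have hc0 : J'.eval 0 ≠ 0 := by
    rwa [X_dvd_iff, coeff_zero_eq_eval_zero] at hnd
  have hlo : (fun z => (f z - (p.coeff 0 : ℂ)) - J'.eval 0 * z ^ (j + 1)) =o[𝓝[UHP] 0]
      fun z => z ^ (j + 1) := by
    have h1 := h.trans_isBigO (isBigO_pow_of_le (show j + 1 ≤ 2 * m + 2 by omega))
    have h2 : (fun z => (J'.eval z - J'.eval 0) * z ^ (j + 1)) =o[𝓝[UHP] 0]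
        fun z => z ^ (j + 1) := by
      have h3 : (fun z => J'.eval z - J'.eval 0) =o[𝓝[UHP] 0] fun _ => (1 : ℂ) :=
        (isLittleO_one_iff ℂ).2 (by simpa using (tendsto_eval J').sub_const (J'.eval 0))
      simpa using h3.mul_isBigO (isBigO_refl (fun z : ℂ => z ^ (j + 1)) (𝓝[UHP] 0))
    refine (h1.add h2).congr_left fun z => ?_
    rw [jet_succ, ← hJ, hJ']
    simp
    ring
  have him : ∀ ζ ∈ UHP, 0 ≤ (J'.eval 0 * ζ ^ (j + 1)).im := fun ζ hζ =>
    im_nonneg_of_isLittleO (fun z hz => by simpa using hf.2 z hz) hlo hζ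
  have hj0 : j = 0 := by
    by_contra hj0
    exact hc0 (eq_zero_of_im_mul_pow_nonneg (by omega) him)
  subst hj0
  have hval : J'.eval 0 = (p.coeff 1 : ℂ) := by
    rw [pow_zero, one_mul] at hJ'
    rw [← hJ', hJ, jet_eval_zero_succ]
    simp [coeff_divX]
  rw [hval] at hc0
  have h1 := him Complex.I (by simp [UHP])
  rw [hval] at h1
  simp at h1
  exact lt_of_le_of_ne h1 fun h0 => hc0 (by rw [← h0]; simp)

/-- A Pick function attains a real value only if it is constant. -/
lemma eq_const_of_im_eq_zero {f : ℂ → ℂ} (hf : f ∈ Pick) {z₀ : ℂ} (hz₀ : z₀ ∈ UHP)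
    (h0 : (f z₀).im = 0) : ∀ z ∈ UHP, f z = f z₀ := by
  rcases hf.1.is_constant_or_isOpen convex_UHP.isPreconnected with ⟨w, hw⟩ | ho
  · intro z hz
    rw [hw z hz, hw z₀ hz₀]
  · exfalso
    have hopen := ho UHP subset_rfl isOpen_UHP
    obtain ⟨δ, hδ, hball⟩ := Metric.isOpen_iff.1 hopen (f z₀) ⟨z₀, hz₀, rfl⟩
    have hmem : f z₀ - (δ / 2 : ℝ) * Complex.I ∈ Metric.ball (f z₀) δ := by
      rw [mem_ball_iff_norm]
      simp [abs_of_pos hδ]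
      linarith
    obtain ⟨z, hz, hfz⟩ := hball hmem
    have := hf.2 z hz
    rw [hfz] at this
    simp [h0] at this
    linarith

/-- Julia's lemma in Nevanlinna's form: splitting off the pole of `-1 / (f - a₀)` at `0` leaves a
Pick function. The imaginary part of the difference is bounded below by that of `1 / (a₁ z)` away
from `0` and has nonnegative limit at `0`, so the maximum principle applies to `exp (i g)` on the
half-planes `Im z > η` as `η → 0`. -/
lemma julia_mem_Pick {f : ℂ → ℂ} {a₀ a₁ : ℝ} {L : ℂ} (hf : f ∈ Pick) (ha₁ : 0 < a₁)
    (hne : ∀ z ∈ UHP, f z - a₀ ≠ 0) (hL : 0 ≤ L.im)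
    (hlim : Tendsto (fun z => 1 / ((a₁ : ℂ) * z) - 1 / (f z - a₀)) (𝓝[UHP] 0) (𝓝 L)) :
    (fun z => 1 / ((a₁ : ℂ) * z) - 1 / (f z - a₀)) ∈ Pick := by
  set g : ℂ → ℂ := fun z => 1 / ((a₁ : ℂ) * z) - 1 / (f z - a₀) with hg
  have han : AnalyticOnNhd ℂ g UHP := by
    intro z hz
    have h1 : (a₁ : ℂ) * z ≠ 0 :=
      mul_ne_zero (Complex.ofReal_ne_zero.2 ha₁.ne') (ne_zero_of_mem_UHP hz)
    exact (analyticAt_const.div (analyticAt_const.mul analyticAt_id) h1).sub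
      (analyticAt_const.div ((hf.1 z hz).sub analyticAt_const) (hne z hz))
  have hlow : ∀ z ∈ UHP, -(z.im / (a₁ * ‖z‖ ^ 2)) ≤ (g z).im := by
    intro z hz
    have h1 : (1 / ((a₁ : ℂ) * z)).im = -(z.im / (a₁ * ‖z‖ ^ 2)) := by
      rw [one_div, mul_inv, ← Complex.ofReal_inv, Complex.im_ofReal_mul, Complex.inv_im,
        Complex.normSq_eq_norm_sq]
      have := norm_pos_iff.2 (ne_zero_of_mem_UHP hz)
      field_simp
    have h2 : (1 / (f z - a₀)).im ≤ 0 := by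
      rw [one_div, Complex.inv_im]
      have := hf.2 z hz
      exact div_nonpos_of_nonpos_of_nonneg (by simpa using this) (Complex.normSq_nonneg _)
    rw [hg]
    simp only [Complex.sub_im]
    rw [h1]
    linarith
  refine ⟨han, fun z₀ hz₀ => ?_⟩
  refine le_of_forall_pos_le_add fun ε hε => ?_
  have hev : ∀ᶠ z in 𝓝[UHP] (0 : ℂ), -ε < (g z).im :=
    ((Complex.continuous_im.tendsto L).comp hlim).eventually (lt_mem_nhds (by linarith))
  rw [eventually_nhdsWithin_iff, Metric.eventually_nhds_iff] at hev
  obtain ⟨δ, hδ, hnear⟩ := hev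
  have hz₀' : 0 < z₀.im := hz₀
  -- Near `0` the limit controls `Im g`; elsewhere on `Im z = η` the choice of `η` does.
  set η : ℝ := min (z₀.im / 2) (ε * a₁ * δ ^ 2) with hη
  have hηpos : 0 < η := lt_min (by linarith) (by positivity)
  set R : ℝ := max (‖z₀‖ + 1) (1 / (a₁ * ε))
  set U : Set ℂ := {z | η < z.im} ∩ Metric.ball 0 R with hU
  have hclU : closure U ⊆ {z | η ≤ z.im} ∩ Metric.closedBall 0 R := by
    refine closure_minimal ?_ ((isClosed_le continuous_const Complex.continuous_im).inter
      Metric.isClosed_closedBall)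
    exact fun z hz => ⟨le_of_lt (show η < z.im from hz.1), Metric.ball_subset_closedBall hz.2⟩
  have hUo : IsOpen U :=
    (isOpen_lt continuous_const Complex.continuous_im).inter Metric.isOpen_ball
  have hsub : closure U ⊆ UHP := fun z hz => lt_of_lt_of_le hηpos (hclU hz).1
  have hdiff : DiffContOnCl ℂ (fun z => Complex.exp (Complex.I * g z)) U := by
    refine DifferentiableOn.diffContOnCl fun z hz => ?_
    exact ((han z (hsub hz)).differentiableAt.const_mul Complex.I).cexp.differentiableWithinAt
  have hnorm : ∀ z, ‖Complex.exp (Complex.I * g z)‖ = Real.exp (-(g z).im) := fun z => by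
    rw [Complex.norm_exp]; simp
  have hfr : ∀ z ∈ frontier U, ‖Complex.exp (Complex.I * g z)‖ ≤ Real.exp ε := by
    intro z hz
    have hzc := hclU (frontier_subset_closure hz)
    have hzU : z ∈ UHP := hsub (frontier_subset_closure hz)
    have hzi : 0 < z.im := hzU
    have hznot : z ∉ U := by
      rw [hUo.frontier_eq] at hz
      exact hz.2
    rw [hnorm, Real.exp_le_exp]
    by_cases hd : ‖z‖ < δ
    · have := hnear (y := z) (by simpa using hd) hzU
      linarith
    push Not at hd
    have hzpos : 0 < ‖z‖ := lt_of_lt_of_le hδ hd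
    suffices z.im / (a₁ * ‖z‖ ^ 2) ≤ ε by linarith [hlow z hzU]
    rw [div_le_iff₀ (by positivity)]
    by_cases hηz : η < z.im
    · have hRz : R ≤ ‖z‖ := by
        by_contra! hlt
        exact hznot ⟨hηz, by simpa using hlt⟩
      have h1 : 1 / (a₁ * ε) ≤ ‖z‖ := (le_max_right _ _).trans hRz
      rw [div_le_iff₀ (by positivity)] at h1
      have h2 : z.im ≤ ‖z‖ := (le_abs_self _).trans (Complex.abs_im_le_norm z)
      calc z.im ≤ ‖z‖ * 1 := by linarith
        _ ≤ ‖z‖ * (‖z‖ * (a₁ * ε)) := by gcongr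
        _ = ε * (a₁ * ‖z‖ ^ 2) := by ring
    · push Not at hηz
      calc z.im ≤ ε * a₁ * δ ^ 2 := hηz.trans (min_le_right _ _)
        _ ≤ ε * a₁ * ‖z‖ ^ 2 := by gcongr
        _ = ε * (a₁ * ‖z‖ ^ 2) := by ring
  have hz₀U : z₀ ∈ U := by
    refine ⟨lt_of_le_of_lt (min_le_left _ _) (half_lt_self hz₀'), ?_⟩
    rw [mem_ball_zero_iff]
    exact lt_of_lt_of_le (lt_add_one _) (le_max_left _ _)
  have hfin := Complex.norm_le_of_forall_mem_frontier_norm_le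
    (Metric.isBounded_ball.subset Set.inter_subset_right) hdiff hfr (subset_closure hz₀U)
  rw [hnorm, Real.exp_le_exp] at hfin
  linarith

/-- One step of the boundary Schur–Nevanlinna algorithm: the Julia reduction of a Pick function is a
Pick function whose jet is the reduced one. -/
lemma exists_julia_reduction {f : ℂ → ℂ} {p q : ℝ[X]} {α : ℂ} {m : ℕ} {K : ℂ[X]}
    (hf : f ∈ Pick) (hα : 0 < α.im)
    (h : (fun z => f z - (jet p α (2 * m + 2)).eval z) =o[𝓝[UHP] 0] fun z => z ^ (2 * m + 2))
    (hq : jet p.divX α (2 * m + 1) *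
          (1 - C (p.coeff 1 : ℂ) * X * jet q (α / (p.coeff 1 : ℂ) ^ 2) (2 * m)) =
        C (p.coeff 1 : ℂ) + X ^ (2 * m + 2) * K) :
    ∃ g ∈ Pick, (fun z => g z - (jet q (α / (p.coeff 1 : ℂ) ^ 2) (2 * m)).eval z) =o[𝓝[UHP] 0]
      fun z => z ^ (2 * m) := by
  have ha₁ := coeff_one_pos hf hα h
  have hJ0 : (jet p.divX α (2 * m + 1)).eval 0 = (p.coeff 1 : ℂ) := by
    rw [jet_eval_zero_succ]; simp [coeff_divX]
  set a₁ := p.coeff 1 with ha₁def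
  set a₀ := p.coeff 0 with ha₀def
  have haC : (a₁ : ℂ) ≠ 0 := Complex.ofReal_ne_zero.2 ha₁.ne'
  set J := jet p.divX α (2 * m + 1) with hJ
  have hTJ : ∀ z, (jet p α (2 * m + 2)).eval z = a₀ + z * J.eval z := fun z => by
    rw [jet_succ]; simp [hJ, ha₀def]
  set G := jet q (α / (a₁ : ℂ) ^ 2) (2 * m) with hG
  -- `Q` is the difference quotient `(f - a₀) / z`.
  set Q : ℂ → ℂ := fun z => (f z - a₀) / z with hQ
  have hQJ : (fun z => Q z - J.eval z) =o[𝓝[UHP] 0] fun z => z ^ (2 * m + 1) := by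
    have h1 := h.mul_isBigO (isBigO_refl (fun z : ℂ => z⁻¹) (𝓝[UHP] 0))
    refine h1.congr' ?_ ?_
    · filter_upwards [self_mem_nhdsWithin] with z hz
      have := ne_zero_of_mem_UHP hz
      rw [hTJ, hQ]
      field_simp
      ring
    · filter_upwards [self_mem_nhdsWithin] with z hz
      have := ne_zero_of_mem_UHP hz
      field_simp
      ring
  have hQlim : Tendsto Q (𝓝[UHP] 0) (𝓝 a₁) := by
    have h1 : Tendsto (fun z => Q z - J.eval z) (𝓝[UHP] 0) (𝓝 0) :=
      (isLittleO_one_iff ℂ).1 (by simpa using hQJ.trans_isBigO (isBigO_pow_of_le (Nat.zero_le _)))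
    simpa [hJ0] using h1.add (tendsto_eval J)
  have hne : ∀ z ∈ UHP, f z - a₀ ≠ 0 := by
    intro z₀ hz₀ h0
    have hfz : f z₀ = a₀ := sub_eq_zero.1 h0
    have hconst := eq_const_of_im_eq_zero hf hz₀ (by rw [hfz]; simp)
    have hQ0 : Q =ᶠ[𝓝[UHP] 0] fun _ => 0 := by
      filter_upwards [self_mem_nhdsWithin] with z hz
      simp [hQ, hconst z hz, hfz]
    exact haC (tendsto_nhds_unique (hQlim.congr' hQ0) tendsto_const_nhds)
  have hident : ∀ z, (J.eval z) * (1 - a₁ * z * G.eval z) = a₁ + z ^ (2 * m + 2) * K.eval z := by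
    intro z
    simpa using congrArg (fun P : ℂ[X] => P.eval z) hq
  have hlo : (fun z => (1 / ((a₁ : ℂ) * z) - 1 / (f z - a₀)) - G.eval z) =o[𝓝[UHP] 0]
      fun z => z ^ (2 * m) := by
    have hS : (fun z : ℂ => 1 - a₁ * z * G.eval z) =O[𝓝[UHP] 0] fun _ => (1 : ℂ) := by
      have : Continuous fun z : ℂ => 1 - a₁ * z * G.eval z := by fun_prop
      exact ((this.tendsto 0).mono_left nhdsWithin_le_nhds).isBigO_one ℂ
    have h1 : (fun z => (1 - a₁ * z * G.eval z) * (Q z - J.eval z)) =o[𝓝[UHP] 0]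
        fun z => z ^ (2 * m + 1) := by
      simpa using hS.mul_isLittleO hQJ
    have h2 : (fun z : ℂ => z ^ (2 * m + 2) * K.eval z) =o[𝓝[UHP] 0]
        fun z => z ^ (2 * m + 1) := by
      have h3 : (fun z : ℂ => z * K.eval z) =o[𝓝[UHP] 0] fun _ => (1 : ℂ) := by
        refine (isLittleO_one_iff ℂ).2 ?_
        have := tendsto_eval (X * K)
        simp only [eval_mul, eval_X, zero_mul] at this
        exact this
      have := (isBigO_refl (fun z : ℂ => z ^ (2 * m + 1)) (𝓝[UHP] 0)).mul_isLittleO h3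
      refine this.congr (fun z => ?_) (fun z => ?_)
      · ring
      · ring
    have h4 : (fun z => ((a₁ : ℂ) * Q z)⁻¹) =O[𝓝[UHP] 0] fun _ => (1 : ℂ) :=
      ((hQlim.const_mul (a₁ : ℂ)).inv₀ (mul_ne_zero haC haC)).isBigO_one ℂ
    have h5 := ((h1.add h2).mul_isBigO h4).mul_isBigO (isBigO_refl (fun z : ℂ => z⁻¹) (𝓝[UHP] 0))
    refine h5.congr' ?_ ?_
    · filter_upwards [self_mem_nhdsWithin] with z hz
      have hz0 := ne_zero_of_mem_UHP hz
      have hfz := hne z hz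
      have hid := hident z
      have hnum : (1 - a₁ * z * G.eval z) * (Q z - J.eval z) + z ^ (2 * m + 2) * K.eval z =
          (1 - a₁ * z * G.eval z) * Q z - a₁ := by linear_combination -hid
      rw [hnum, hQ]
      field_simp
      ring
    · filter_upwards [self_mem_nhdsWithin] with z hz
      have hz0 := ne_zero_of_mem_UHP hz
      field_simp
      ring
  refine ⟨_, julia_mem_Pick (L := G.eval 0) hf ha₁ hne ?_ ?_, hlo⟩
  · rcases Nat.eq_zero_or_pos m with rfl | hm
    · rw [hG, Nat.mul_zero, jet_eval_zero_zero, ← Complex.ofReal_pow]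
      simp only [Complex.add_im, Complex.ofReal_im, zero_add, Complex.div_ofReal_im]
      positivity
    · obtain ⟨d, hd⟩ : ∃ d, 2 * m = d + 1 := ⟨2 * m - 1, by omega⟩
      rw [hG, hd, jet_eval_zero_succ]
      simp
  · have h1 : Tendsto (fun z => (1 / ((a₁ : ℂ) * z) - 1 / (f z - a₀)) - G.eval z) (𝓝[UHP] 0)
        (𝓝 0) :=
      (isLittleO_one_iff ℂ).1 (by simpa using hlo.trans_isBigO (isBigO_pow_of_le (Nat.zero_le _)))
    simpa using h1.add (tendsto_eval G)

/-! ### Pencils of rational interpolants -/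

/-- `N / D` maps the closed upper half-plane without `0` into the upper half-plane, has the
jet `p + α X²ᵐ` at `0` up to order `2m`, and has at most a simple zero there. Positivity of
`Im (N / D)` is written without division, so that it includes `D ≠ 0`. -/
structure IsInterpolant (m : ℕ) (p : ℝ[X]) (α : ℂ) (N D : ℂ[X]) : Prop where
  im_pos : ∀ z : ℂ, 0 ≤ z.im → z ≠ 0 → 0 < (N.eval z * conj (D.eval z)).im
  denom_zero : D.eval 0 ≠ 0
  jet_dvd : X ^ (2 * m + 1) ∣ N - jet p α (2 * m) * D
  simple_zero : N.eval 0 ≠ 0 ∨ (derivative N).eval 0 ≠ 0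

/-- A pencil `(N₀ + τ N₁) / (D₀ + τ D₁)`, `τ > 0`, of interpolants. The coefficient conditions say
that the limits `N₀ / D₀` and `N₁ / D₁` of the pencil have values in the upper half-plane
at `∞`, with denominators of degree exactly `m + 1` and `m`. -/
structure IsPencil (m : ℕ) (p : ℝ[X]) (α : ℂ) (N₀ N₁ D₀ D₁ : ℂ[X]) : Prop where
  natDegree_N₀ : N₀.natDegree ≤ m + 1
  natDegree_D₀ : D₀.natDegree ≤ m + 1
  natDegree_N₁ : N₁.natDegree ≤ m
  natDegree_D₁ : D₁.natDegree ≤ m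
  coeff_im_pos₀ : 0 < (N₀.coeff (m + 1) * conj (D₀.coeff (m + 1))).im
  coeff_im_pos₁ : 0 < (N₁.coeff m * conj (D₁.coeff m)).im
  det_eq : ∃ c : ℂ, c ≠ 0 ∧ N₀ * D₁ - N₁ * D₀ = C c * X ^ (2 * m + 1)
  isInterpolant : ∀ τ : ℝ, 0 < τ →
    IsInterpolant m p α (N₀ + C (τ : ℂ) * N₁) (D₀ + C (τ : ℂ) * D₁)

/-- The functions `a + i z / (z + i τ)`, where `a = p(0) + α`. -/
lemma isPencil_zero (p : ℝ[X]) {α : ℂ} (hα : 0 < α.im) :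
    IsPencil 0 p α (C ((p.coeff 0 : ℂ) + α + Complex.I) * X) (C (Complex.I * (p.coeff 0 + α)))
      X (C Complex.I) where
  natDegree_N₀ := (natDegree_C_mul_le _ _).trans natDegree_X_le
  natDegree_D₀ := by simp
  natDegree_N₁ := (natDegree_C _).le
  natDegree_D₁ := by simp
  coeff_im_pos₀ := by simp; linarith
  coeff_im_pos₁ := by simp; linarith
  det_eq := ⟨-1, by simp, by
    simp only [C_add, C_mul, C_neg, C_1]
    have : (C Complex.I : ℂ[X]) * C Complex.I = -1 := by rw [← C_mul, Complex.I_mul_I]; simp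
    linear_combination X * this⟩
  isInterpolant τ hτ := by
    refine ⟨fun z hz hz0 => ?_, ?_, ?_, Or.inl ?_⟩
    · have hn : 0 < z.re ^ 2 + z.im ^ 2 := by
        have := Complex.normSq_pos.2 hz0
        rw [Complex.normSq_apply] at this
        nlinarith
      have key : (((p.coeff 0 : ℂ) + α + Complex.I) * z + τ * (Complex.I * (p.coeff 0 + α))) *
          conj (z + τ * Complex.I) = ((p.coeff 0 : ℂ) + α) *
            (Complex.normSq (z + τ * Complex.I) : ℂ) + Complex.I * z * conj (z + τ * Complex.I) := by
        rw [← Complex.mul_conj]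
        ring
      have him : (Complex.I * z * conj (z + τ * Complex.I)).im =
          z.re ^ 2 + z.im ^ 2 + τ * z.im := by
        simp
        ring
      simp only [eval_add, eval_mul, eval_C, eval_X]
      rw [key, Complex.add_im, him, Complex.im_mul_ofReal]
      have h1 : 0 ≤ ((p.coeff 0 : ℂ) + α).im * Complex.normSq (z + τ * Complex.I) :=
        mul_nonneg (by simpa using hα.le) (Complex.normSq_nonneg _)
      have h2 := mul_nonneg hτ.le hz
      linarith
    · simpa using hτ.ne'
    · rw [pow_one, X_dvd_iff, coeff_zero_eq_eval_zero]
      simp only [Nat.mul_zero, eval_sub, eval_mul, jet_eval_zero_zero, eval_add, eval_C, eval_X]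
      ring
    · have h1 : (p.coeff 0 : ℂ) + α ≠ 0 := by
        intro h
        have := congrArg Complex.im h
        simp at this
        exact hα.ne' this
      simpa [hτ.ne'] using h1

/-- The inverse `g ↦ a₀ + a₁ z / (1 - a₁ z g)` of the Julia reduction, on interpolants. -/
lemma IsInterpolant.julia {m : ℕ} {p q : ℝ[X]} {α : ℂ} {K N D : ℂ[X]} (ha₁ : 0 < p.coeff 1)
    (hq : jet p.divX α (2 * m + 1) *
          (1 - C (p.coeff 1 : ℂ) * X * jet q (α / (p.coeff 1 : ℂ) ^ 2) (2 * m)) =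
        C (p.coeff 1 : ℂ) + X ^ (2 * m + 2) * K)
    (h : IsInterpolant m q (α / (p.coeff 1 : ℂ) ^ 2) N D) :
    IsInterpolant (m + 1) p α
      (C (p.coeff 0 : ℂ) * (D - C (p.coeff 1 : ℂ) * X * N) + C (p.coeff 1 : ℂ) * X * D)
      (D - C (p.coeff 1 : ℂ) * X * N) := by
  obtain ⟨him, hD, ⟨r, hr⟩, -⟩ := h
  have hT : jet p α (2 * (m + 1)) = C (p.coeff 0 : ℂ) + X * jet p.divX α (2 * m + 1) :=
    jet_succ p α (2 * m + 1)
  generalize p.coeff 1 = a₁ at *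
  generalize p.coeff 0 = a₀ at *
  refine ⟨fun z hz hz0 => ?_, by simpa using hD, ?_, ?_⟩
  · simp only [eval_add, eval_sub, eval_mul, eval_C, eval_X]
    set n := N.eval z
    set d := D.eval z
    have key : (a₀ * (d - a₁ * z * n) + a₁ * z * d) * conj (d - a₁ * z * n) =
        (a₀ * Complex.normSq (d - a₁ * z * n) : ℝ) + (a₁ * Complex.normSq d : ℝ) * z
          - (a₁ ^ 2 * Complex.normSq z : ℝ) * conj (n * conj d) := by
      push_cast
      rw [← Complex.mul_conj, ← Complex.mul_conj, ← Complex.mul_conj]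
      simp only [map_sub, map_mul, Complex.conj_ofReal, Complex.conj_conj]
      ring
    rw [key]
    have h1 := him z hz hz0
    simp only [Complex.add_im, Complex.sub_im, Complex.ofReal_im, Complex.im_ofReal_mul,
      Complex.conj_im]
    have h2 : 0 ≤ a₁ * Complex.normSq d * z.im :=
      mul_nonneg (mul_nonneg ha₁.le (Complex.normSq_nonneg _)) hz
    have h3 : 0 < a₁ ^ 2 * Complex.normSq z * (n * conj d).im :=
      mul_pos (mul_pos (by positivity) (Complex.normSq_pos.2 hz0)) h1
    linarith
  · refine ⟨C (a₁ : ℂ) * jet p.divX α (2 * m + 1) * r - D * K, ?_⟩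
    rw [hT]
    generalize jet p.divX α (2 * m + 1) = J at *
    generalize jet q (α / (a₁ : ℂ) ^ 2) (2 * m) = G at *
    linear_combination (-X * D) * hq + (C (a₁ : ℂ) * J * X ^ 2) * hr
  · by_cases ha₀ : a₀ = 0
    · right
      subst ha₀
      simpa using ⟨ha₁.ne', hD⟩
    · left
      simpa using ⟨ha₀, hD⟩

/-- The inverse of the Julia reduction acts on pencils. -/
lemma IsPencil.julia {m : ℕ} {p q : ℝ[X]} {α : ℂ} {K N₀ N₁ D₀ D₁ : ℂ[X]} (ha₁ : 0 < p.coeff 1)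
    (hq : jet p.divX α (2 * m + 1) *
          (1 - C (p.coeff 1 : ℂ) * X * jet q (α / (p.coeff 1 : ℂ) ^ 2) (2 * m)) =
        C (p.coeff 1 : ℂ) + X ^ (2 * m + 2) * K)
    (h : IsPencil m q (α / (p.coeff 1 : ℂ) ^ 2) N₀ N₁ D₀ D₁) :
    IsPencil (m + 1) p α
      (C (p.coeff 0 : ℂ) * (D₀ - C (p.coeff 1 : ℂ) * X * N₀) + C (p.coeff 1 : ℂ) * X * D₀)
      (C (p.coeff 0 : ℂ) * (D₁ - C (p.coeff 1 : ℂ) * X * N₁) + C (p.coeff 1 : ℂ) * X * D₁)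
      (D₀ - C (p.coeff 1 : ℂ) * X * N₀) (D₁ - C (p.coeff 1 : ℂ) * X * N₁) := by
  have hXdeg : ∀ {P : ℂ[X]} {k : ℕ} (c : ℝ), P.natDegree ≤ k →
      (C (c : ℂ) * X * P).natDegree ≤ k + 1 := by
    intro P k c hP
    rw [mul_assoc]
    refine (natDegree_C_mul_le _ _).trans (natDegree_mul_le.trans ?_)
    rw [natDegree_X]
    omega
  have hsubdeg : ∀ {P Q : ℂ[X]} {k : ℕ} (c : ℝ), P.natDegree ≤ k → Q.natDegree ≤ k →
      (P - C (c : ℂ) * X * Q).natDegree ≤ k + 1 := fun c hP hQ =>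
    (natDegree_sub_le_of_le (hP.trans (Nat.le_succ _)) (hXdeg c hQ)).trans (max_self _).le
  have hadddeg : ∀ {P Q : ℂ[X]} {k : ℕ} (b c : ℝ), P.natDegree ≤ k → Q.natDegree ≤ k →
      (C (b : ℂ) * (P - C (c : ℂ) * X * Q) + C (c : ℂ) * X * P).natDegree ≤ k + 1 :=
    fun b c hP hQ =>
    natDegree_add_le_of_degree_le ((natDegree_C_mul_le _ _).trans (hsubdeg c hP hQ)) (hXdeg c hP)
  have hcoef : ∀ {P Q : ℂ[X]} {k : ℕ} {b c : ℝ}, 0 < c → P.natDegree ≤ k →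
      0 < (Q.coeff k * conj (P.coeff k)).im →
      0 < ((C (b : ℂ) * (P - C (c : ℂ) * X * Q) + C (c : ℂ) * X * P).coeff (k + 1) *
        conj ((P - C (c : ℂ) * X * Q).coeff (k + 1))).im := by
    intro P Q k b c hc hP him
    have h0 : P.coeff (k + 1) = 0 := coeff_eq_zero_of_natDegree_lt (by omega)
    have h1 : (b * (0 - c * Q.coeff k) + c * P.coeff k) * conj (0 - c * Q.coeff k) =
        (b * c ^ 2 * Complex.normSq (Q.coeff k) : ℝ)
          - (c ^ 2 : ℝ) * conj (Q.coeff k * conj (P.coeff k)) := by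
      push_cast
      rw [← Complex.mul_conj]
      simp only [map_sub, map_mul, Complex.conj_ofReal, Complex.conj_conj, map_zero]
      ring
    simp only [mul_assoc (C (c : ℂ)), coeff_add, coeff_sub, coeff_C_mul, coeff_X_mul, h0]
    rw [h1, Complex.sub_im, Complex.ofReal_im, Complex.im_ofReal_mul, Complex.conj_im]
    have := mul_pos (pow_pos hc 2) him
    linarith
  refine ⟨hadddeg _ _ h.natDegree_D₀ h.natDegree_N₀, hsubdeg _ h.natDegree_D₀ h.natDegree_N₀,
    hadddeg _ _ h.natDegree_D₁ h.natDegree_N₁, hsubdeg _ h.natDegree_D₁ h.natDegree_N₁,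
    hcoef ha₁ h.natDegree_D₀ h.coeff_im_pos₀, hcoef ha₁ h.natDegree_D₁ h.coeff_im_pos₁, ?_,
    fun τ hτ => ?_⟩
  · obtain ⟨c, hc, hdet⟩ := h.det_eq
    refine ⟨(p.coeff 1 : ℂ) ^ 2 * c,
      mul_ne_zero (pow_ne_zero 2 (Complex.ofReal_ne_zero.2 ha₁.ne')) hc, ?_⟩
    rw [C_mul, C_pow]
    linear_combination (C (p.coeff 1 : ℂ) ^ 2 * X ^ 2) * hdet
  · convert (h.isInterpolant τ hτ).julia ha₁ hq using 1 <;> ring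

/-- Every jet of a Pick function is interpolated by a pencil. -/
lemma exists_isPencil (m : ℕ) : ∀ (p : ℝ[X]) (α : ℂ) (f : ℂ → ℂ), f ∈ Pick → 0 < α.im →
    (fun z => f z - (jet p α (2 * m)).eval z) =o[𝓝[UHP] 0] (fun z => z ^ (2 * m)) →
    ∃ N₀ N₁ D₀ D₁ : ℂ[X], IsPencil m p α N₀ N₁ D₀ D₁ := by
  induction m with
  | zero =>
    intro p α f _ hα _
    exact ⟨_, _, _, _, isPencil_zero p hα⟩
  | succ m ih =>
    intro p α f hf hα h
    have ha₁ := coeff_one_pos (m := m) hf hα h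
    obtain ⟨q, K, hq⟩ := exists_reduced_jet p α m ha₁.ne'
    obtain ⟨g, hg, hlo⟩ := exists_julia_reduction (m := m) hf hα h hq
    have hβ : 0 < (α / (p.coeff 1 : ℂ) ^ 2).im := by
      rw [← Complex.ofReal_pow, Complex.div_ofReal_im]
      positivity
    obtain ⟨N₀, N₁, D₀, D₁, hP⟩ := ih q _ g hg hβ hlo
    exact ⟨_, _, _, _, hP.julia ha₁ hq⟩

/-- Some member of the pencil has only simple zeros. A multiple zero of `N₀ + τ N₁` is a zero of
the Wronskian of `N₀` and `N₁`, and outside `0` these have no common zero, so that each zero of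
the Wronskian excludes one value of `τ`. -/
lemma IsPencil.exists_simple_zeros {m : ℕ} {p : ℝ[X]} {α : ℂ} {N₀ N₁ D₀ D₁ : ℂ[X]}
    (h : IsPencil m p α N₀ N₁ D₀ D₁) :
    ∃ τ : ℝ, 0 < τ ∧ ∀ z, ¬((N₀ + C (τ : ℂ) * N₁).IsRoot z ∧
      (derivative (N₀ + C (τ : ℂ) * N₁)).IsRoot z) := by
  have hν₀ : N₀.coeff (m + 1) ≠ 0 := fun h0 => by simpa [h0] using h.coeff_im_pos₀
  have hν₁ : N₁.coeff m ≠ 0 := fun h0 => by simpa [h0] using h.coeff_im_pos₁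
  set W := derivative N₀ * N₁ - N₀ * derivative N₁ with hWdef
  -- The coefficient of `X W` in degree `2 m + 1` is `((m + 1) - m)` times the product of the
  -- leading coefficients.
  have hW : W ≠ 0 := by
    intro hW
    have hXd : ∀ P : ℂ[X], ∀ k, (X * derivative P).coeff k = k * P.coeff k := by
      intro P k
      cases k with
      | zero => simp
      | succ k => rw [coeff_X_mul, coeff_derivative]; push_cast; ring
    have hXdeg : ∀ {P : ℂ[X]} {k : ℕ}, P.natDegree ≤ k → (X * derivative P).natDegree ≤ k := by
      intro P k hP
      rw [natDegree_le_iff_coeff_eq_zero] at hP ⊢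
      intro j hj
      rw [hXd, hP j hj, mul_zero]
    have hXW : (X * derivative N₀) * N₁ - N₀ * (X * derivative N₁) = 0 := by
      rw [← mul_zero X, ← hW]; ring
    have hc := congrArg (fun P : ℂ[X] => P.coeff ((m + 1) + m)) hXW
    simp only [coeff_sub, coeff_zero] at hc
    rw [coeff_mul_add_eq_of_natDegree_le (hXdeg h.natDegree_N₀) h.natDegree_N₁,
      coeff_mul_add_eq_of_natDegree_le h.natDegree_N₀ (hXdeg h.natDegree_N₁), hXd, hXd] at hc
    have : N₀.coeff (m + 1) * N₁.coeff m = 0 := by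
      push_cast at hc
      linear_combination hc
    exact mul_ne_zero hν₀ hν₁ this
  obtain ⟨c, hc, hdet⟩ := h.det_eq
  have hfin : ((fun z => -(N₀.eval z / N₁.eval z).re) '' (W.roots.toFinset : Set ℂ)).Finite :=
    (W.roots.toFinset.finite_toSet).image _
  obtain ⟨τ, hτ, hτn⟩ := (Set.Ioi_infinite (0 : ℝ)).exists_notMem_finite hfin
  refine ⟨τ, hτ, ?_⟩
  rintro z ⟨hz, hz'⟩
  have hz0 : z ≠ 0 := by
    rintro rfl
    exact (h.isInterpolant τ hτ).simple_zero.elim (fun h => h hz) fun h => h hz'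
  simp only [IsRoot, derivative_add, derivative_C_mul, eval_add, eval_mul, eval_C] at hz hz'
  have hN₁ : N₁.eval z ≠ 0 := by
    intro h0
    have h1 := congrArg (fun P : ℂ[X] => P.eval z) hdet
    have h2 : N₀.eval z = 0 := by simpa [h0] using hz
    simp [h0, h2] at h1
    exact h1.elim hc hz0
  refine hτn ⟨z, ?_, ?_⟩
  · rw [Finset.mem_coe, Multiset.mem_toFinset, mem_roots hW, IsRoot, hWdef, eval_sub, eval_mul,
      eval_mul]
    linear_combination N₁.eval z * hz' - (derivative N₁).eval z * hz
  · have : N₀.eval z / N₁.eval z = -(τ : ℂ) := by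
      rw [div_eq_iff hN₁]
      linear_combination hz
    simp [this]

/-! ### From polynomials to rational functions -/

lemma IsPencil.isCoprime {m : ℕ} {p : ℝ[X]} {α : ℂ} {N₀ N₁ D₀ D₁ : ℂ[X]}
    (h : IsPencil m p α N₀ N₁ D₀ D₁) {τ : ℝ} (hτ : 0 < τ) :
    IsCoprime (N₀ + C (τ : ℂ) * N₁) (D₀ + C (τ : ℂ) * D₁) := by
  rw [isCoprime_iff_aeval_ne_zero_of_isAlgClosed ℂ ℂ]
  intro z
  by_contra! hz
  simp only [coe_aeval_eq_eval] at hz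
  obtain ⟨c, hc, hdet⟩ := h.det_eq
  have hz0 : z ≠ 0 := by
    rintro rfl
    exact (h.isInterpolant τ hτ).denom_zero hz.2
  have h1 := congrArg (fun P : ℂ[X] => P.eval z) hdet
  simp only [eval_add, eval_sub, eval_mul, eval_C, eval_pow, eval_X] at h1 hz
  have h2 : c * z ^ (2 * m + 1) = 0 := by
    rw [← h1]
    linear_combination D₁.eval z * hz.1 - N₁.eval z * hz.2
  exact mul_ne_zero hc (pow_ne_zero _ hz0) h2

/-- A coprime representation of a rational function is the one in lowest terms, up to a common
constant factor. -/
lemma exists_num_denom_eq_C_mul {N D : ℂ[X]} (hD : D ≠ 0) (hND : IsCoprime N D) :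
    ∃ c : ℂ, c ≠ 0 ∧
      (algebraMap ℂ[X] (RatFunc ℂ) N / algebraMap ℂ[X] (RatFunc ℂ) D).num = C c * N ∧
      (algebraMap ℂ[X] (RatFunc ℂ) N / algebraMap ℂ[X] (RatFunc ℂ) D).denom = C c * D := by
  have hg : gcd N D = 1 := by
    rw [← normalize_gcd, normalize_eq_one, gcd_isUnit_iff]
    exact hND
  refine ⟨D.leadingCoeff⁻¹, inv_ne_zero (leadingCoeff_ne_zero.2 hD), ?_, ?_⟩
  · rw [RatFunc.num_div, hg, EuclideanDomain.div_one, EuclideanDomain.div_one]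
  · rw [RatFunc.denom_div _ hD, hg, EuclideanDomain.div_one]

lemma iteratedDeriv_eval (P : ℂ[X]) (k : ℕ) :
    iteratedDeriv k (fun z => P.eval z) = fun z => (derivative^[k] P).eval z := by
  induction k with
  | zero => simp
  | succ k ih =>
    rw [iteratedDeriv_succ, ih, Function.iterate_succ_apply']
    ext z
    exact Polynomial.deriv _

/-- Agreement to order `n` in the divisibility sense determines the Taylor coefficients. -/
lemma hasTaylorCoeffs_div {N D T : ℂ[X]} {n : ℕ} {a : ℕ → ℂ} (hD : D.eval 0 ≠ 0)
    (h : X ^ (n + 1) ∣ N - T * D) (hT : ∀ k ≤ n, T.coeff k = a k) :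
    HasTaylorCoeffs (fun z => N.eval z / D.eval z) n a := by
  have han : ∀ P : ℂ[X], AnalyticAt ℂ (fun z => P.eval z) 0 := fun P =>
    P.differentiable.analyticAt 0
  have hF : AnalyticAt ℂ (fun z => N.eval z / D.eval z) 0 := (han N).div (han D) hD
  refine ⟨hF, fun k hk => ?_⟩
  obtain ⟨r, hr⟩ := h
  have hord : ((n + 1 : ℕ) : ℕ∞) ≤
      analyticOrderAt ((fun z => N.eval z / D.eval z) - fun z => T.eval z) 0 := by
    rw [natCast_le_analyticOrderAt (hF.sub (han T))]
    refine ⟨fun z => r.eval z / D.eval z, (han r).div (han D) hD, ?_⟩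
    filter_upwards [(han D).continuousAt.eventually_ne hD] with z hz
    have h1 := congrArg (fun P : ℂ[X] => P.eval z) hr
    simp only [eval_sub, eval_mul, eval_pow, eval_X] at h1
    simp only [Pi.sub_apply, sub_zero, smul_eq_mul]
    rw [← mul_div_assoc, eq_div_iff hz, ← h1, sub_mul, div_mul_cancel₀ _ hz]
  have h0 := (natCast_le_analyticOrderAt_iff_iteratedDeriv_eq_zero (hF.sub (han T))).1 hord k
    (by omega)
  rw [iteratedDeriv_sub hF.contDiffAt (han T).contDiffAt, iteratedDeriv_eval] at h0
  beta_reduce at h0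
  rw [← coeff_zero_eq_eval_zero, coeff_iterate_derivative, zero_add, Nat.descFactorial_self,
    nsmul_eq_mul, hT k hk, sub_eq_zero] at h0
  rw [h0, mul_div_cancel_left₀ _ (Nat.cast_ne_zero.2 k.factorial_ne_zero)]

lemma im_div_pos_iff {w v : ℂ} (hv : v ≠ 0) : 0 < (w / v).im ↔ 0 < (w * conj v).im := by
  have h : w / v = w * conj v * ((Complex.normSq v)⁻¹ : ℝ) := by
    rw [div_eq_mul_inv, Complex.inv_def, mul_assoc]
  rw [h, Complex.im_mul_ofReal]
  exact mul_pos_iff_of_pos_right (inv_pos.2 (Complex.normSq_pos.2 hv))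

/-- An interpolant in lowest terms, of full degree, with simple zeros and with value in the upper
half-plane at `∞` is a rational function with the required properties. -/
lemma exists_solution_of_interpolant {m : ℕ} {p : ℝ[X]} {α : ℂ} {N D : ℂ[X]} {a : ℕ → ℂ}
    (h : IsInterpolant m p α N D) (hND : IsCoprime N D) (hN : N.natDegree ≤ m + 1)
    (hD : D.natDegree ≤ m + 1) (hlead : 0 < (N.coeff (m + 1) * conj (D.coeff (m + 1))).im)
    (hsimple : ∀ z, ¬(N.IsRoot z ∧ (derivative N).IsRoot z))
    (hT : ∀ k ≤ 2 * m, (jet p α (2 * m)).coeff k = a k) :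
    ∃ R : RatFunc ℂ,
      degree R = m + 1 ∧
      toFun R ∈ PickAt 0 ∧
      HasTaylorCoeffs (toFun R) (2 * m) a ∧
      Set.MapsTo (sphereMap R) (extendedReals \ {((0 : ℂ) : OnePoint ℂ)})
        ((fun z : ℂ => (z : OnePoint ℂ)) '' UHP) ∧
      IsRegularValue R ((0 : ℂ) : OnePoint ℂ) := by
  have hνN : N.coeff (m + 1) ≠ 0 := fun h0 => by simp [h0] at hlead
  have hνD : D.coeff (m + 1) ≠ 0 := fun h0 => by simp [h0] at hlead
  have hN0 : N ≠ 0 := fun h0 => hνN (by simp [h0])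
  have hD0 : D ≠ 0 := fun h0 => hνD (by simp [h0])
  have hdN : N.natDegree = m + 1 := le_antisymm hN (le_natDegree_of_ne_zero hνN)
  have hdD : D.natDegree = m + 1 := le_antisymm hD (le_natDegree_of_ne_zero hνD)
  have hDz : ∀ z : ℂ, 0 ≤ z.im → D.eval z ≠ 0 := by
    intro z hz h0
    by_cases hz0 : z = 0
    · subst hz0
      exact h.denom_zero h0
    · simpa [h0] using h.im_pos z hz hz0
  have hpos : ∀ z : ℂ, 0 ≤ z.im → z ≠ 0 → 0 < (N.eval z / D.eval z).im := fun z hz hz0 =>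
    (im_div_pos_iff (hDz z hz)).2 (h.im_pos z hz hz0)
  obtain ⟨c, hc, hnum, hden⟩ := exists_num_denom_eq_C_mul hD0 hND
  set R := algebraMap ℂ[X] (RatFunc ℂ) N / algebraMap ℂ[X] (RatFunc ℂ) D
  have hdeg : degree R = m + 1 := by
    rw [degree, hnum, hden, natDegree_C_mul hc, natDegree_C_mul hc, hdN, hdD, max_self]
  have hfun : toFun R = fun z => N.eval z / D.eval z := by
    ext z
    rw [toFun, RatFunc.eval, hnum, hden]
    simp only [eval₂_id, eval_mul, eval_C]
    exact mul_div_mul_left _ _ hc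
  have hsphere : ∀ z : ℂ, D.eval z ≠ 0 →
      sphereMap R (z : OnePoint ℂ) = ((N.eval z / D.eval z : ℂ) : OnePoint ℂ) := by
    intro z hz
    change (if R.denom.eval z = 0 then OnePoint.infty
      else ((R.num.eval z / R.denom.eval z : ℂ) : OnePoint ℂ)) = _
    rw [hnum, hden, eval_mul, eval_mul, eval_C, if_neg (mul_ne_zero hc hz),
      mul_div_mul_left _ _ hc]
  have hpole : ∀ z : ℂ, D.eval z = 0 → sphereMap R (z : OnePoint ℂ) = OnePoint.infty := by
    intro z hz
    change (if R.denom.eval z = 0 then OnePoint.infty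
      else ((R.num.eval z / R.denom.eval z : ℂ) : OnePoint ℂ)) = _
    rw [hden, eval_mul, hz, mul_zero, if_pos rfl]
  have hinfty : sphereMap R OnePoint.infty =
      ((N.coeff (m + 1) / D.coeff (m + 1) : ℂ) : OnePoint ℂ) := by
    change (if R.denom.natDegree < R.num.natDegree then OnePoint.infty
      else ((R.num.coeff R.denom.natDegree / R.denom.leadingCoeff : ℂ) : OnePoint ℂ)) = _
    rw [leadingCoeff, hnum, hden, natDegree_C_mul hc, natDegree_C_mul hc, hdN, hdD,
      if_neg (lt_irrefl _), coeff_C_mul, coeff_C_mul, mul_div_mul_left _ _ hc]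
  have hTay : HasTaylorCoeffs (toFun R) (2 * m) a := by
    rw [hfun]
    exact hasTaylorCoeffs_div h.denom_zero h.jet_dvd hT
  refine ⟨R, hdeg, ⟨⟨?_, ?_⟩, by simpa using hTay.1⟩, hTay, ?_, ?_⟩
  · rw [hfun]
    intro z hz
    exact (N.differentiable.analyticAt z).div (D.differentiable.analyticAt z)
      (hDz z (le_of_lt hz))
  · rw [hfun]
    exact fun z hz => (hpos z (le_of_lt hz) (ne_zero_of_mem_UHP hz)).le
  · rintro w ⟨hw | ⟨x, rfl⟩, hw0⟩
    · rw [hw, hinfty]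
      exact ⟨_, (im_div_pos_iff hνD).2 hlead, rfl⟩
    · have hx0 : (x : ℂ) ≠ 0 := fun h0 => hw0 (by simp [h0])
      have hx : (0 : ℝ) ≤ (x : ℂ).im := by simp
      change sphereMap R ((x : ℂ) : OnePoint ℂ) ∈ _
      rw [hsphere _ (hDz _ hx)]
      exact ⟨_, hpos _ hx hx0, rfl⟩
  · have hset : sphereMap R ⁻¹' {((0 : ℂ) : OnePoint ℂ)} =
        (fun z : ℂ => (z : OnePoint ℂ)) '' (N.roots.toFinset : Set ℂ) := by
      ext w
      induction w using OnePoint.rec with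
      | infty =>
        rw [Set.mem_preimage, hinfty]
        simp [hνN, hνD]
      | coe z =>
        rw [Set.mem_preimage]
        by_cases hz : D.eval z = 0
        · have hNz : N.eval z ≠ 0 := by
            have := (isCoprime_iff_aeval_ne_zero_of_isAlgClosed ℂ ℂ N D).1 hND z
            simpa [hz] using this
          rw [hpole z hz]
          simp [hNz, hN0]
        · rw [hsphere z hz]
          simp [hz, hN0]
    have hnodup : N.roots.Nodup := by
      rw [Multiset.nodup_iff_count_le_one]
      intro z
      rw [count_roots]
      by_contra! hlt
      exact hsimple z ((one_lt_rootMultiplicity_iff_isRoot hN0).1 hlt)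
    rw [IsRegularValue, hset, OnePoint.coe_injective.encard_image, Set.encard_coe_eq_coe_finsetCard,
      Multiset.toFinset_card_of_nodup hnodup, IsAlgClosed.card_roots_eq_natDegree, hdN, hdeg]

end PickInterp

theorem mainTheorem9 (m : ℕ) (a : ℕ → ℂ) (f : ℂ → ℂ)
    (hf : f ∈ PickInterp.Pick)
    (hfa : PickInterp.HasPseudoTaylorCoeffs f (2 * m) a)
    (ha_real : ∀ k < 2 * m, (a k).im = 0)
    (ha_last : a (2 * m) ∈ PickInterp.UHP) :
    ∃ R : RatFunc ℂ,
      PickInterp.degree R = m + 1 ∧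
      PickInterp.toFun R ∈ PickInterp.PickAt 0 ∧
      PickInterp.HasTaylorCoeffs (PickInterp.toFun R) (2 * m) a ∧
      Set.MapsTo (PickInterp.sphereMap R)
        (PickInterp.extendedReals \ {((0 : ℂ) : OnePoint ℂ)})
        ((fun z : ℂ => (z : OnePoint ℂ)) '' PickInterp.UHP) ∧
      PickInterp.IsRegularValue R ((0 : ℂ) : OnePoint ℂ) := by
  open PickInterp Polynomial in
  set p : ℝ[X] := ∑ k ∈ Finset.range (2 * m), C (a k).re * X ^ k with hp
  have hT : ∀ k ≤ 2 * m, (jet p (a (2 * m)) (2 * m)).coeff k = a k := by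
    intro k hk
    have hpk : p.coeff k = if k < 2 * m then (a k).re else 0 := by
      simp [hp, finsetSum_coeff, coeff_C_mul, coeff_X_pow]
    rw [jet, coeff_add, coeff_map, coeff_C_mul, coeff_X_pow, hpk]
    rcases hk.lt_or_eq with hlt | rfl
    · simp only [hlt, hlt.ne, if_true, if_false, mul_zero, add_zero]
      exact Complex.ext (by simp) (by simp [ha_real k hlt])
    · simp
  obtain ⟨N₀, N₁, D₀, D₁, hP⟩ := exists_isPencil m p _ f hf ha_last (hfa.isLittleO _ hf hT)
  obtain ⟨τ, hτ, hsimple⟩ := hP.exists_simple_zeros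
  have hN₁ : N₁.coeff (m + 1) = 0 :=
    coeff_eq_zero_of_natDegree_lt (Nat.lt_succ_of_le hP.natDegree_N₁)
  have hD₁ : D₁.coeff (m + 1) = 0 :=
    coeff_eq_zero_of_natDegree_lt (Nat.lt_succ_of_le hP.natDegree_D₁)
  refine exists_solution_of_interpolant (hP.isInterpolant τ hτ) (hP.isCoprime hτ)
    (natDegree_add_le_of_degree_le hP.natDegree_N₀
      ((natDegree_C_mul_le _ _).trans (hP.natDegree_N₁.trans (Nat.le_succ m))))
    (natDegree_add_le_of_degree_le hP.natDegree_D₀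
      ((natDegree_C_mul_le _ _).trans (hP.natDegree_D₁.trans (Nat.le_succ m)))) ?_ hsimple hT
  simpa only [coeff_add, coeff_C_mul, hN₁, hD₁, mul_zero, add_zero] using hP.coeff_im_pos₀
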